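/- Definitions. A $k$-distinguisher on a vertex set $\mathcal V$ is an undirected $k$-hypergraph $g$, that is, a set $E_g\subseteq\mathcal V^k$ of $k$-tuples that is invariant under permutations of the coordinates (tuples with repeated entries are allowed; for $k=1$ it is a subset of $\mathcal V$, for $k=2$ a graph in which self-loops are allowed). A $k$-distinguishing class is a set of $k$-distinguishers on $\mathcal V$. For a probability distribution $P$ on $\mathcal V$ put $L_P(g)=P^k(E_g)$, and for a class $\mathcal G$ put $\mathrm{IPM}_{\mathcal G}(p_1,p_2)=\sup_{g\in\mathcal G}|L_{p_1}(g)-L_{p_2}(g)|$. The VC dimension of a $1$-distinguishing class $\mathcal D$ is the supremum of the sizes of the finite sets $S\subseteq\mathcal V$ all of whose subsets are of the form $S\cap d$ with $d\in\mathcal D$. A $\mathcal G$-discriminating algorithm with sample complexity $m(\epsilon,\delta)$ maps any pair of finite samples of vertices to an element of $\mathcal G$ so that, for all $\epsilon>0$, all $\delta\in(0,1)$ and all distributions $p_1,p_2$ on $\mathcal V$: if $S_1,S_2$ are independent i.i.d. samples from $p_1,p_2$ with $|S_1|,|S_2|>m(\epsilon,\delta)$, then with probability at least $1-\delta$ the output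 $g$ satisfies $|L_{p_1}(g)-L_{p_2}(g)|>\mathrm{IPM}_{\mathcal G}(p_1,p_2)-\epsilon$. A class has sample complexity $m$ if it has such an algorithm. Theorem. Let $\mathcal V=\mathbb N$. There is an absolute constant $C>0$ such that the following hold. (1) There is a single graph $g$ on $\mathcal V$ such that the class $\{g\}$ has sample complexity $C\log(1/\delta)/\epsilon^2$ and, for every $1$-distinguishing class $\mathcal D$ of finite VC dimension and every $\epsilon>0$, there are distributions $p_1,p_2$ on $\mathcal V$ with $\mathrm{IPM}_{\mathcal D}(p_1,p_2)<\epsilon$ and $\mathrm{IPM}_{\{g\}}(p_1,p_2)>\tfrac12$. (2) Let the elements of $\mathcal V$ be listed, by any bijection, as $v_i$ ($i\in\mathbb N$) and $v_A$ ($A\subset\mathbb N$ finite), and let $g$ be the bipartite graph whose edges join $v_i$ and $v_A$ exactly when $i\in A$. Then the class $\{g\}$ has sample complexity $C\log(1/\delta)/\epsilon^2$ and, for every $1$-distinguishing class $\mathcal D$ of finite VC dimension and every $\epsilon>0$, there are distributions $p_1,p_2$ on $\mathcal V$ with $\mathrm{IPM}_{\mathcal D}(p_1,p_2)<\epsilon$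 and $\mathrm{IPM}_{\{g\}}(p_1,p_2)\ge\tfrac12$. -/

import Mathlib

open MeasureTheory

namespace GraphDiscriminator

/-- A `k`-distinguisher on the vertex set `V`: an undirected `k`-hypergraph, given by its set of
hyperedges, which are `k`-tuples of vertices, closed under permutation of the coordinates
(tuples with repeated vertices, such as self-loops, are allowed). -/
@[ext]
structure Distinguisher (V : Type*) (k : ℕ) where
  /-- the set of hyperedges -/
  edges : Set (Fin k → V)
  /-- the hypergraph is undirected -/
  undirected : ∀ (π : Equiv.Perm (Fin k)) (v : Fin k → V), v ∘ π ∈ edges ↔ v ∈ edges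

/-- The frequency `L_P(g) = P^k(E_g)` of an edge of `g` under the distribution `P`. -/
noncomputable def edgeFreq {V : Type*} [MeasurableSpace V] {k : ℕ}
    (P : ProbabilityMeasure V) (g : Distinguisher V k) : ℝ :=
  (Measure.pi fun _ : Fin k => (P : Measure V)).real g.edges

/-- The IPM distance `sup_{g ∈ G} |L_{p₁}(g) - L_{p₂}(g)|` of a `k`-distinguishing class `G`.
The supremum is over reals in `[0, 1]`; it is `0` for the empty class. -/
noncomputable def IPM {V : Type*} [MeasurableSpace V] {k : ℕ}
    (G : Set (Distinguisher V k)) (p₁ p₂ : ProbabilityMeasure V) : ℝ :=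
  ⨆ g : G, |edgeFreq p₁ (g : Distinguisher V k) - edgeFreq p₂ (g : Distinguisher V k)|

/-- The finite vertex set `S` is shattered by the `1`-distinguishing class `D`: every subset of `S`
is the trace on `S` of a member of `D`. -/
def Shatters {V : Type*} (D : Set (Distinguisher V 1)) (S : Finset V) : Prop :=
  ∀ T ⊆ S, ∃ d ∈ D, ∀ v ∈ S, (fun _ => v) ∈ d.edges ↔ v ∈ T

/-- The VC dimension of a `1`-distinguishing class: the supremum of the sizes of shattered sets. -/
noncomputable def vcDim {V : Type*} (D : Set (Distinguisher V 1)) : ℕ∞ :=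
  ⨆ S : {S : Finset V // Shatters D S}, ((S : Finset V).card : ℕ∞)

/-- `A` is a `G`-discriminating algorithm with sample complexity `m ε δ`: from any two finite
samples it outputs a member of `G` and, when the samples are drawn independently and identically
from unknown distributions `p₁`, `p₂` and have more than `m ε δ` points each, then with probability
at least `1 - δ` the output `g` satisfies `|L_{p₁}(g) - L_{p₂}(g)| > IPM_G(p₁, p₂) - ε`. -/
def IsDiscriminatingAlgorithm {V : Type*} [MeasurableSpace V] {k : ℕ}
    (G : Set (Distinguisher V k))
    (A : (n₁ n₂ : ℕ) → (Fin n₁ → V) → (Fin n₂ → V) → Distinguisher V k)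
    (m : ℝ → ℝ → ℝ) : Prop :=
  (∀ n₁ n₂ S₁ S₂, A n₁ n₂ S₁ S₂ ∈ G) ∧
  ∀ ε δ : ℝ, 0 < ε → 0 < δ → δ < 1 →
    ∀ (p₁ p₂ : ProbabilityMeasure V) (n₁ n₂ : ℕ), m ε δ < n₁ → m ε δ < n₂ →
      1 - δ ≤ ((Measure.pi fun _ : Fin n₁ => (p₁ : Measure V)).prod
          (Measure.pi fun _ : Fin n₂ => (p₂ : Measure V))).real
        {S | IPM G p₁ p₂ - ε <
          |edgeFreq p₁ (A n₁ n₂ S.1 S.2) - edgeFreq p₂ (A n₁ n₂ S.1 S.2)|}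

/-- The class `G` has sample complexity at most `m`: some `G`-discriminating algorithm has sample
complexity `m`. -/
def HasSampleComplexity {V : Type*} [MeasurableSpace V] {k : ℕ}
    (G : Set (Distinguisher V k)) (m : ℝ → ℝ → ℝ) : Prop :=
  ∃ A, IsDiscriminatingAlgorithm G A m

/-- The bipartite graph of the membership relation. The bijection `e` splits the vertices into the
vertices `v_i = e.symm (inl i)`, for `i : ℕ`, and the vertices `v_A = e.symm (inr A)`, for the
finite sets `A` of natural numbers; `v_i` and `v_A` are joined iff `i ∈ A`, and there are no other
edges. -/
def membershipGraph {V : Type*} (e : V ≃ ℕ ⊕ Finset ℕ) : Distinguisher V 2 where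
  edges := {v | ∃ (i : ℕ) (A : Finset ℕ) (σ : Equiv.Perm (Fin 2)), i ∈ A ∧
    v (σ 0) = e.symm (Sum.inl i) ∧ v (σ 1) = e.symm (Sum.inr A)}
  undirected := by
    intro π v
    constructor
    · rintro ⟨i, A, σ, h, h0, h1⟩
      exact ⟨i, A, π * σ, h, h0, h1⟩
    · rintro ⟨i, A, σ, h, h0, h1⟩
      exact ⟨i, A, π⁻¹ * σ, h, by simpa using h0, by simpa using h1⟩

end GraphDiscriminator

open GraphDiscriminator

/-! A class with one member needs no samples at all, so everything lies in the separation. Split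
each of `n` pairs of vertices at random into two halves. By a Chernoff bound a fixed set of vertices
tells the halves apart by `c * n` with probability exponentially small in `n`, whereas a class of
finite VC dimension has only polynomially many traces on the `2 * n` vertices (`card_traces_le`).
Hence some splitting is balanced for all traces, and the uniform distributions on its halves are
close but disjointly supported (`exists_close_disjoint`). The graph then tells the two supports
apart. In the membership graph, one vertex `v_A` is joined to all of one support and to none of the
other; mixing both distributions with the point mass at `v_A` gives frequencies at least `1/2` and
exactly `0`. In a graph with the extension property, a new close pair can be placed on vertices
joined to all of the first support and to none of the second; each such mixing halves the distance
of the two frequencies from `1` and `0`. -/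

namespace GraphDiscriminator

/-! ### Balanced splittings by exponential moments. -/

/-- The contribution of the pair `i` to the discrepancy of `T` when the elements of the pairs
`(i, true)`, `(i, false)` are separated by the choice `b`. -/
def pairDiff {ι : Type*} [DecidableEq ι] (T : Finset (ι × Bool)) (i : ι) (b : Bool) : ℝ :=
  (if (i, b) ∈ T then 1 else 0) - (if (i, !b) ∈ T then 1 else 0)

/-- A pair inside or outside `T` contributes `0`; a pair cut by `T` contributes `1` or `-1`, giving
`2 * cosh c`. -/
lemma sum_exp_pairDiff_le {ι : Type*} [DecidableEq ι] (T : Finset (ι × Bool)) (i : ι) (c : ℝ) :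
    ∑ b, Real.exp (c * pairDiff T i b) ≤ 2 * Real.exp (c ^ 2 / 2) := by
  have h1 := Real.cosh_le_exp_half_sq c
  rw [Real.cosh_eq] at h1
  have h2 : (1 : ℝ) ≤ Real.exp (c ^ 2 / 2) := Real.one_le_exp (by positivity)
  rw [Fintype.sum_bool]
  unfold pairDiff
  by_cases ht : (i, true) ∈ T <;> by_cases hf : (i, false) ∈ T <;> simp [ht, hf] <;> linarith

/-- The choices in different pairs are independent, so the exponential moment factorises. -/
lemma sum_exp_sum_pairDiff_le {ι : Type*} [Fintype ι] [DecidableEq ι] (T : Finset (ι × Bool))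
    (c : ℝ) :
    ∑ σ : ι → Bool, Real.exp (c * ∑ i, pairDiff T i (σ i)) ≤
      2 ^ Fintype.card ι * Real.exp (c ^ 2 / 2 * Fintype.card ι) := by
  calc ∑ σ : ι → Bool, Real.exp (c * ∑ i, pairDiff T i (σ i))
      = ∏ i : ι, ∑ b, Real.exp (c * pairDiff T i b) := by
        rw [Finset.prod_univ_sum, Fintype.piFinset_univ]
        simp only [Finset.mul_sum, Real.exp_sum]
    _ ≤ ∏ _i : ι, 2 * Real.exp (c ^ 2 / 2) :=
        Finset.prod_le_prod (fun i _ => Finset.sum_nonneg fun b _ => (Real.exp_pos _).le)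
          fun i _ => sum_exp_pairDiff_le T i c
    _ = _ := by
        rw [Finset.prod_const, Finset.card_univ, mul_pow, ← Real.exp_nat_mul, mul_comm (c ^ 2 / 2)]

/-- A family of few sets of elements of pairs admits a splitting of the pairs
which is balanced for each of its members. -/
lemma exists_balanced_splitting {ι : Type*} [Fintype ι] [DecidableEq ι]
    (𝒜 : Finset (Finset (ι × Bool))) {c : ℝ} (hc : 0 < c)
    (h : 2 * (𝒜.card : ℝ) < Real.exp (c ^ 2 / 2 * Fintype.card ι)) :
    ∃ σ : ι → Bool, ∀ T ∈ 𝒜, |∑ i, pairDiff T i (σ i)| < c * Fintype.card ι := by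
  set N : ℝ := ((Fintype.card ι : ℕ) : ℝ)
  -- Both signs are included so that one average over `σ` bounds the absolute value for all `T` at
  -- once. With exponent parameter equal to the target deviation `c`, the threshold is `exp (c ^ 2 *
  -- N)`.
  set F : (ι → Bool) → Finset (ι × Bool) → ℝ := fun σ T =>
    Real.exp (c * ∑ i, pairDiff T i (σ i)) + Real.exp (-c * ∑ i, pairDiff T i (σ i)) with hF
  have hsum : ∑ σ, ∑ T ∈ 𝒜, F σ T ≤
      ∑ _σ : ι → Bool, 2 * 𝒜.card * Real.exp (c ^ 2 / 2 * N) := by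
    rw [Finset.sum_comm]
    calc ∑ T ∈ 𝒜, ∑ σ, F σ T
        ≤ ∑ _T ∈ 𝒜, 2 * (2 ^ Fintype.card ι * Real.exp (c ^ 2 / 2 * N)) := by
          refine Finset.sum_le_sum fun T _ => ?_
          have h1 := sum_exp_sum_pairDiff_le T c
          have h2 := sum_exp_sum_pairDiff_le T (-c)
          rw [neg_sq] at h2
          rw [hF, Finset.sum_add_distrib]
          linarith
      _ = _ := by
          simp only [Finset.sum_const, nsmul_eq_mul, Finset.card_univ, Fintype.card_fun,
            Fintype.card_bool]
          push_cast
          ring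
  obtain ⟨σ, -, hσ⟩ := Finset.exists_le_of_sum_le Finset.univ_nonempty hsum
  refine ⟨σ, fun T hT => ?_⟩
  have h1 : F σ T ≤ ∑ T ∈ 𝒜, F σ T :=
    Finset.single_le_sum (f := F σ) (fun T _ => by positivity) hT
  have h2 : F σ T < Real.exp (c ^ 2 * N) := by
    calc F σ T ≤ 2 * 𝒜.card * Real.exp (c ^ 2 / 2 * N) := h1.trans hσ
      _ < Real.exp (c ^ 2 / 2 * N) * Real.exp (c ^ 2 / 2 * N) := by gcongr
      _ = _ := by rw [← Real.exp_add]; congr 1; ring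
  have h3 := Real.exp_pos (c * ∑ i, pairDiff T i (σ i))
  have h4 := Real.exp_pos (-c * ∑ i, pairDiff T i (σ i))
  have h5 : c * ∑ i, pairDiff T i (σ i) < c ^ 2 * N :=
    Real.exp_lt_exp.1 (by simp only [hF] at h2; linarith)
  have h6 : -c * ∑ i, pairDiff T i (σ i) < c ^ 2 * N :=
    Real.exp_lt_exp.1 (by simp only [hF] at h2; linarith)
  rw [abs_lt]
  constructor <;> refine lt_of_mul_lt_mul_left ?_ hc.le <;> linarith

/-! ### Counting the traces of a class of finite VC dimension. -/

lemma exists_shatters_card_le {V : Type*} {D : Set (Distinguisher V 1)} (hD : vcDim D < ⊤) :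
    ∃ d : ℕ, ∀ S : Finset V, Shatters D S → S.card ≤ d := by
  obtain ⟨d, hd⟩ := ENat.ne_top_iff_exists.1 hD.ne
  refine ⟨d, fun S hS => ?_⟩
  have h : (S.card : ℕ∞) ≤ vcDim D :=
    le_iSup (fun S : {S : Finset V // Shatters D S} => ((S : Finset V).card : ℕ∞)) ⟨S, hS⟩
  rw [← hd] at h
  exact_mod_cast h

open Classical in
/-- The traces of the members of the class `D` on a finite family `u` of vertices. -/
noncomputable def traces {V ι : Type*} [Fintype ι] (D : Set (Distinguisher V 1)) (u : ι → V) :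
    Finset (Finset ι) :=
  Finset.univ.filter fun T => ∃ d ∈ D, ∀ i, i ∈ T ↔ (fun _ => u i) ∈ d.edges

/-- The Sauer-Shelah bound for the number of traces, in polynomial form. -/
lemma card_traces_le {V ι : Type*} [Fintype ι] [Nonempty ι] {D : Set (Distinguisher V 1)} {d : ℕ}
    (hd : ∀ S : Finset V, Shatters D S → S.card ≤ d) {u : ι → V} (hu : u.Injective) :
    (traces D u).card ≤ (d + 1) * Fintype.card ι ^ d := by
  classical
  have hvc : (traces D u).vcDim ≤ d := by
    refine Finset.sup_le fun s hs => ?_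
    rw [Finset.mem_shatterer] at hs
    -- A set of indices shattered by the traces is carried by the injection `u` to a set of vertices
    -- shattered by `D`.
    rw [← Finset.card_map ⟨u, hu⟩]
    refine hd _ fun T hT => ?_
    obtain ⟨t, ht, rfl⟩ := Finset.subset_map_iff.1 hT
    obtain ⟨w, hw, hwt⟩ := hs ht
    obtain ⟨e, he, hew⟩ := (Finset.mem_filter.1 hw).2
    refine ⟨e, he, fun v hv => ?_⟩
    obtain ⟨i, hi, rfl⟩ := Finset.mem_map.1 hv
    rw [Finset.mem_map' ⟨u, hu⟩, ← hwt, Finset.mem_inter]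
    simp only [Function.Embedding.coeFn_mk, hi, true_and]
    exact (hew i).symm
  calc (traces D u).card ≤ ∑ k ∈ Finset.Iic (traces D u).vcDim, (Fintype.card ι).choose k :=
        (Finset.card_le_card_shatterer _).trans Finset.card_shatterer_le_sum_vcDim
    _ ≤ ∑ k ∈ Finset.Iic d, (Fintype.card ι).choose k :=
        Finset.sum_le_sum_of_subset (Finset.Iic_subset_Iic.2 hvc)
    _ ≤ ∑ _k ∈ Finset.Iic d, Fintype.card ι ^ d :=
        Finset.sum_le_sum fun k hk => (Nat.choose_le_pow _ _).trans
          (Nat.pow_le_pow_right Fintype.card_pos (Finset.mem_Iic.1 hk))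
    _ = _ := by simp

/-- Supplies a number `n` of pairs for which the concentration beats the number of traces on their
`2 * n` elements. -/
lemma exists_pow_lt_exp (d : ℕ) (A : ℝ) {c : ℝ} (hc : 0 < c) :
    ∃ n : ℕ, 0 < n ∧ A * (2 * n : ℝ) ^ d < Real.exp (c * n) := by
  have h1 : Filter.Tendsto (fun n : ℕ => c * (n : ℝ)) Filter.atTop Filter.atTop :=
    tendsto_natCast_atTop_atTop.const_mul_atTop hc
  have h2 := ((Real.tendsto_pow_mul_exp_neg_atTop_nhds_zero d).comp h1).const_mul (A * (2 / c) ^ d)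
  rw [mul_zero] at h2
  obtain ⟨n, hn, hn0⟩ := ((h2.eventually_lt_const one_pos).and
    (Filter.eventually_gt_atTop 0)).exists
  refine ⟨n, hn0, ?_⟩
  have h3 : A * (2 / c) ^ d * ((c * n) ^ d * Real.exp (-(c * n))) < 1 := hn
  rw [Real.exp_neg, ← mul_assoc, ← div_eq_mul_inv, div_lt_one (Real.exp_pos _)] at h3
  calc A * (2 * n : ℝ) ^ d = A * (2 / c) ^ d * (c * n) ^ d := by
        rw [mul_assoc, ← mul_pow]; congr 2; field_simp
    _ < _ := h3

end GraphDiscriminator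

namespace GraphDiscriminator

/-! ### Edge frequencies of mixtures, and close distributions with disjoint supports. -/

section Measures

variable {V : Type*} [MeasurableSpace V]

/-- The uniform distribution on a finite family of vertices. -/
noncomputable def empirical {ι : Type*} [Fintype ι] [Nonempty ι] (x : ι → V) :
    ProbabilityMeasure V :=
  ⟨(Fintype.card ι : ENNReal)⁻¹ • ∑ i, Measure.dirac (x i), ⟨by
    simp [ENNReal.inv_mul_cancel]⟩⟩

lemma empirical_real {ι : Type*} [Fintype ι] [Nonempty ι] (x : ι → V) {s : Set V}
    (hs : MeasurableSet s) :
    (empirical x : Measure V).real s = (Fintype.card ι : ℝ)⁻¹ * ∑ i, s.indicator 1 (x i) := by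
  simp only [empirical, ProbabilityMeasure.coe_mk, Measure.real,
    Measure.smul_apply, Measure.finsetSum_apply, Measure.dirac_apply' _ hs, smul_eq_mul,
    ENNReal.toReal_mul, ENNReal.toReal_inv, ENNReal.toReal_natCast]
  rw [ENNReal.toReal_sum fun i _ => by by_cases h : x i ∈ s <;> simp [h]]
  congr 1
  refine Finset.sum_congr rfl fun i _ => ?_
  by_cases h : x i ∈ s <;> simp [h]

lemma ae_empirical {ι : Type*} [Fintype ι] [Nonempty ι] (x : ι → V) {s : Set V}
    (hs : MeasurableSet s) (h : ∀ i, x i ∈ s) : ∀ᵐ v ∂(empirical x : Measure V), v ∈ s := by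
  rw [ae_iff]
  have hs' : {v | v ∉ s} = sᶜ := rfl
  simp [empirical, hs', Measure.dirac_apply' _ hs.compl, h]

/-- The equal mixture of two distributions. -/
noncomputable def mix (P Q : ProbabilityMeasure V) : ProbabilityMeasure V :=
  ⟨(2 : ENNReal)⁻¹ • ((P : Measure V) + Q), ⟨by
    simp [ENNReal.inv_two_add_inv_two]⟩⟩

lemma coe_mix (P Q : ProbabilityMeasure V) :
    (mix P Q : Measure V) = (2 : ENNReal)⁻¹ • ((P : Measure V) + Q) := rfl

lemma ae_mix {P Q : ProbabilityMeasure V} {p : V → Prop} (hP : ∀ᵐ v ∂(P : Measure V), p v)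
    (hQ : ∀ᵐ v ∂(Q : Measure V), p v) : ∀ᵐ v ∂(mix P Q : Measure V), p v := by
  rw [ae_iff] at *
  simp [coe_mix, hP, hQ]

lemma edgeFreq_nonneg {k : ℕ} (P : ProbabilityMeasure V) (g : Distinguisher V k) :
    0 ≤ edgeFreq P g := measureReal_nonneg

lemma edgeFreq_le_one {k : ℕ} (P : ProbabilityMeasure V) (g : Distinguisher V k) :
    edgeFreq P g ≤ 1 := measureReal_le_one

lemma edgeFreq_one (P : ProbabilityMeasure V) (d : Distinguisher V 1) :
    edgeFreq P d = (P : Measure V).real {v | (fun _ => v) ∈ d.edges} := by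
  have h := (measurePreserving_funUnique (P : Measure V) (Fin 1)).measure_preimage_equiv
    {v | (fun _ => v) ∈ d.edges}
  rw [Measure.real, ← h, edgeFreq, Measure.real]
  congr 2
  ext v
  have : (fun _ => v 0) = v := funext fun i => congrArg v (Subsingleton.elim _ _)
  simp [this]

lemma edgeFreq_mix_one (P Q : ProbabilityMeasure V) (d : Distinguisher V 1) :
    edgeFreq (mix P Q) d = (edgeFreq P d + edgeFreq Q d) / 2 := by
  simp only [edgeFreq_one, coe_mix, measureReal_ennreal_smul_apply]
  rw [measureReal_add_apply]
  simp
  ring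

/-- The probability that two independent vertices with distributions `P` and `Q` are joined. -/
noncomputable def jointFreq (P Q : ProbabilityMeasure V) (g : Distinguisher V 2) : ℝ :=
  ((P : Measure V).prod Q).real {x | ![x.1, x.2] ∈ g.edges}

lemma edgeFreq_two (P : ProbabilityMeasure V) (g : Distinguisher V 2) :
    edgeFreq P g = jointFreq P P g := by
  have h := (measurePreserving_finTwoArrow (P : Measure V)).measure_preimage_equiv
    {x | ![x.1, x.2] ∈ g.edges}
  rw [jointFreq, Measure.real, ← h, edgeFreq, Measure.real]
  congr 2
  ext v
  have : ![v 0, v 1] = v := by ext i; fin_cases i <;> rfl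
  simp [this]

/-- The cross terms are the ones that adjacency between the two supports forces to be `0` or `1`. -/
lemma edgeFreq_mix_two (P Q : ProbabilityMeasure V) (g : Distinguisher V 2) :
    edgeFreq (mix P Q) g =
      (edgeFreq P g + jointFreq P Q g + jointFreq Q P g + edgeFreq Q g) / 4 := by
  simp only [edgeFreq_two, jointFreq, coe_mix]
  rw [Measure.prod_smul_left, Measure.prod_smul_right]
  rw [Measure.add_prod, Measure.prod_add, Measure.prod_add]
  simp only [measureReal_ennreal_smul_apply]
  rw [measureReal_add_apply, measureReal_add_apply, measureReal_add_apply]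
  simp
  ring

lemma ae_prod_mem {P Q : ProbabilityMeasure V} {p q : V → Prop}
    (hP : ∀ᵐ v ∂(P : Measure V), p v) (hQ : ∀ᵐ v ∂(Q : Measure V), q v) :
    ∀ᵐ x ∂((P : Measure V).prod Q), p x.1 ∧ q x.2 :=
  (Measure.quasiMeasurePreserving_fst.ae hP).and (Measure.quasiMeasurePreserving_snd.ae hQ)

lemma jointFreq_eq_one {P Q : ProbabilityMeasure V} {g : Distinguisher V 2} {p q : V → Prop}
    (hP : ∀ᵐ v ∂(P : Measure V), p v) (hQ : ∀ᵐ v ∂(Q : Measure V), q v)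
    (h : ∀ x y, p x → q y → ![x, y] ∈ g.edges) : jointFreq P Q g = 1 := by
  rw [jointFreq, measureReal_congr (t := Set.univ)]
  · simp
  · filter_upwards [ae_prod_mem hP hQ] with x hx
    exact eq_true (h _ _ hx.1 hx.2)

lemma jointFreq_eq_zero {P Q : ProbabilityMeasure V} {g : Distinguisher V 2} {p q : V → Prop}
    (hP : ∀ᵐ v ∂(P : Measure V), p v) (hQ : ∀ᵐ v ∂(Q : Measure V), q v)
    (h : ∀ x y, p x → q y → ![x, y] ∉ g.edges) : jointFreq P Q g = 0 := by
  rw [jointFreq, measureReal_congr (t := ∅)]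
  · simp
  · filter_upwards [ae_prod_mem hP hQ] with x hx
    exact eq_false (h _ _ hx.1 hx.2)

lemma IPM_singleton {k : ℕ} (g : Distinguisher V k) (P Q : ProbabilityMeasure V) :
    IPM {g} P Q = |edgeFreq P g - edgeFreq Q g| := by
  rw [IPM]; exact ciSup_unique

/-- A supremum may attain its bound, so strictness is bought with `ε / 2`; positivity covers the
empty class. -/
lemma IPM_lt {k : ℕ} {D : Set (Distinguisher V k)} {P Q : ProbabilityMeasure V} {ε : ℝ}
    (hε : 0 < ε) (h : ∀ d ∈ D, |edgeFreq P d - edgeFreq Q d| < ε / 2) : IPM D P Q < ε :=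
  lt_of_le_of_lt (Real.iSup_le (fun d : D => (h d d.2).le) (by positivity)) (by linarith)

/-- A class with one member has every sample complexity. -/
lemma hasSampleComplexity_singleton {k : ℕ} (g : Distinguisher V k) (m : ℝ → ℝ → ℝ) :
    HasSampleComplexity {g} m := by
  refine ⟨fun _ _ _ _ => g, fun _ _ _ _ => rfl, fun ε δ hε hδ _ p₁ p₂ n₁ n₂ _ _ => ?_⟩
  simp only [IPM_singleton]
  rw [Set.eq_univ_of_forall (s := {S | _}) fun S => by
    show _ - ε < _
    linarith]
  simp [hδ.le]

/-- Every infinite set of vertices carries two distributions with disjoint finite supports that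
are indistinguishable, up to `ε`, for a class of finite VC dimension. -/
lemma exists_close_disjoint [DiscreteMeasurableSpace V] {D : Set (Distinguisher V 1)}
    (hD : vcDim D < ⊤) {ε : ℝ} (hε : 0 < ε) {W : Set V} (hW : W.Infinite) :
    ∃ (P Q : ProbabilityMeasure V) (X Y : Finset V), ↑X ⊆ W ∧ ↑Y ⊆ W ∧ Disjoint X Y ∧
      (∀ᵐ v ∂(P : Measure V), v ∈ X) ∧ (∀ᵐ v ∂(Q : Measure V), v ∈ Y) ∧
      ∀ d ∈ D, |edgeFreq P d - edgeFreq Q d| < ε := by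
  classical
  obtain ⟨d, hd⟩ := exists_shatters_card_le hD
  -- The factor `2 * (d + 1)` joins the two signs in the union bound to the Sauer-Shelah constant.
  obtain ⟨n, hn, hexp⟩ := exists_pow_lt_exp d (2 * (d + 1)) (c := ε ^ 2 / 2) (by positivity)
  have : Nonempty (Fin n) := ⟨⟨0, hn⟩⟩
  have : Infinite W := hW.to_subtype
  obtain ⟨f⟩ : Nonempty (Fin n × Bool ↪ W) := by
    let e := (Fintype.equivFin (Fin n × Bool)).toEmbedding
    exact ⟨e.trans (Fin.valEmbedding.trans (Infinite.natEmbedding W))⟩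
  set u : Fin n × Bool → V := fun i => f i
  have hu : u.Injective := Subtype.val_injective.comp f.injective
  obtain ⟨σ, hσ⟩ := exists_balanced_splitting (traces D u) hε (by
    have h1 : ((traces D u).card : ℝ) ≤ (d + 1) * (2 * n) ^ d := by
      have := card_traces_le hd hu
      simp only [Fintype.card_prod, Fintype.card_fin, Fintype.card_bool, mul_comm n 2] at this
      exact_mod_cast this
    rw [Fintype.card_fin]
    linarith)
  refine ⟨empirical fun i => u (i, σ i), empirical fun i => u (i, !σ i),
    Finset.univ.image fun i => u (i, σ i), Finset.univ.image fun i => u (i, !σ i),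
    ?_, ?_, ?_, ?_, ?_, fun e he => ?_⟩
  · intro v hv
    obtain ⟨i, -, rfl⟩ := Finset.mem_image.1 (Finset.mem_coe.1 hv)
    exact (f _).2
  · intro v hv
    obtain ⟨i, -, rfl⟩ := Finset.mem_image.1 (Finset.mem_coe.1 hv)
    exact (f _).2
  · rw [Finset.disjoint_left]
    intro v hv hv'
    obtain ⟨i, -, rfl⟩ := Finset.mem_image.1 hv
    obtain ⟨j, -, hj⟩ := Finset.mem_image.1 hv'
    obtain ⟨rfl, h⟩ := Prod.mk.inj (hu hj)
    simp at h
  · exact ae_empirical _ (s := ((Finset.univ.image fun i => u (i, σ i) : Finset V) : Set V))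
      .of_discrete fun i => Finset.mem_coe.2 (Finset.mem_image_of_mem _ (Finset.mem_univ i))
  · exact ae_empirical _ (s := ((Finset.univ.image fun i => u (i, !σ i) : Finset V) : Set V))
      .of_discrete fun i => Finset.mem_coe.2 (Finset.mem_image_of_mem _ (Finset.mem_univ i))
  -- The difference of frequencies is `1 / n` times the discrepancy of the trace `T`.
  · set T : Finset (Fin n × Bool) := Finset.univ.filter fun i => (fun _ => u i) ∈ e.edges with hT
    have h := hσ T (Finset.mem_filter.2 ⟨Finset.mem_univ _, e, he, fun i => by simp [hT]⟩)
    have hn' : (0 : ℝ) < n := by exact_mod_cast hn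
    rw [edgeFreq_one, edgeFreq_one, empirical_real _ .of_discrete, empirical_real _ .of_discrete,
      ← mul_sub, ← Finset.sum_sub_distrib, Fintype.card_fin, abs_mul, abs_of_pos (inv_pos.2 hn'),
      inv_mul_lt_iff₀ hn', mul_comm]
    rw [Fintype.card_fin] at h
    refine lt_of_eq_of_lt (congrArg _ (Finset.sum_congr rfl fun i _ => ?_)) h
    simp [pairDiff, hT, Set.indicator_apply]

end Measures

end GraphDiscriminator

namespace GraphDiscriminator

/-! ### The two graphs and their separating distributions. -/

/-- The graph that joins `x` and `y` whenever `x` belongs to the finite set encoded by `y`, or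
conversely. Like the Rado graph it has the extension property. -/
def extensionGraph {V : Type*} (φ : V ≃ Finset V) : Distinguisher V 2 where
  edges := {v | ∃ σ : Equiv.Perm (Fin 2), v (σ 0) ∈ φ (v (σ 1))}
  undirected := by
    intro π v
    constructor
    · rintro ⟨σ, h⟩
      exact ⟨π * σ, h⟩
    · rintro ⟨σ, h⟩
      exact ⟨π⁻¹ * σ, by simpa using h⟩

lemma perm_fin_two (σ : Equiv.Perm (Fin 2)) :
    (σ 0 = 0 ∧ σ 1 = 1) ∨ (σ 0 = 1 ∧ σ 1 = 0) := by
  revert σ; decide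

lemma mem_extensionGraph {V : Type*} (φ : V ≃ Finset V) (x y : V) :
    ![x, y] ∈ (extensionGraph φ).edges ↔ x ∈ φ y ∨ y ∈ φ x := by
  constructor
  · rintro ⟨σ, h⟩
    obtain ⟨h0, h1⟩ | ⟨h0, h1⟩ := perm_fin_two σ <;> rw [h0, h1] at h
    exacts [.inl h, .inr h]
  · rintro (h | h)
    exacts [⟨1, h⟩, ⟨Equiv.swap 0 1, by simpa using h⟩]

lemma mem_membershipGraph {V : Type*} (e : V ≃ ℕ ⊕ Finset ℕ) (x y : V) :
    ![x, y] ∈ (membershipGraph e).edges ↔ ∃ (i : ℕ) (A : Finset ℕ), i ∈ A ∧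
      ((x = e.symm (.inl i) ∧ y = e.symm (.inr A)) ∨
        (y = e.symm (.inl i) ∧ x = e.symm (.inr A))) := by
  constructor
  · rintro ⟨i, A, σ, hi, h, h'⟩
    refine ⟨i, A, hi, ?_⟩
    obtain ⟨h0, h1⟩ | ⟨h0, h1⟩ := perm_fin_two σ <;> rw [h0] at h <;> rw [h1] at h'
    exacts [.inl ⟨h, h'⟩, .inr ⟨h, h'⟩]
  · rintro ⟨i, A, hi, h | h⟩
    exacts [⟨i, A, 1, hi, h⟩, ⟨i, A, Equiv.swap 0 1, hi, by simpa using h⟩]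

/-- The extension property: infinitely many vertices are joined to all of `F` and to none
of `F'`. -/
lemma infinite_extension {V : Type*} [Infinite V] (φ : V ≃ Finset V) {F F' : Finset V}
    (hF : Disjoint F F') :
    {v | v ∉ F ∧ v ∉ F' ∧ (∀ x ∈ F, x ∈ φ v) ∧ ∀ x ∈ F', x ∉ φ v ∧ v ∉ φ x}.Infinite := by
  classical
  have h1 : ((F ∪ F' : Finset V) : Set V)ᶜ.Infinite := (Finset.finite_toSet _).infinite_compl
  -- Distinct `a` outside `F` give distinct codes `insert a F`, hence infinitely many candidates.
  have h2 : ((fun a => φ.symm (insert a F)) '' ((F ∪ F' : Finset V) : Set V)ᶜ).Infinite := by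
    refine h1.image fun a ha b hb hab => ?_
    have ha' : a ∉ F := fun h => ha (by simp [h])
    have : a ∈ insert b F := by
      rw [← φ.symm.injective hab]
      exact Finset.mem_insert_self _ _
    exact (Finset.mem_insert.1 this).resolve_right ha'
  -- Edges also arise from `v ∈ φ x`; for `x ∈ F'` this rules out only finitely many `v`.
  refine (h2.sdiff (Finset.finite_toSet (F ∪ F' ∪ F'.biUnion φ))).mono ?_
  rintro _ ⟨⟨a, ha, rfl⟩, hv⟩
  simp only [Finset.coe_union, Set.mem_compl_iff, Set.mem_union, Finset.mem_coe, not_or] at ha hv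
  refine ⟨hv.1.1, hv.1.2, fun x hx => by simp [hx], fun x hx => ⟨?_, fun h => ?_⟩⟩
  · have hxa : x ≠ a := fun h => ha.2 (h ▸ hx)
    simp [hxa, Finset.disjoint_right.1 hF hx]
  · exact hv.2 (Finset.mem_biUnion.2 ⟨x, hx, h⟩)

/-- Indistinguishable distributions on the extension graph, the first almost complete and the second
almost edgeless. -/
lemma exists_close_extensionGraph {V : Type*} [MeasurableSpace V] [DiscreteMeasurableSpace V]
    [Infinite V] [DecidableEq V] (φ : V ≃ Finset V) {D : Set (Distinguisher V 1)} (hD : vcDim D < ⊤) {ε : ℝ}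
    (hε : 0 < ε) (j : ℕ) {F F' : Finset V} (hF : Disjoint F F') :
    ∃ (P Q : ProbabilityMeasure V) (X Y : Finset V), Disjoint X Y ∧
      (∀ v ∈ X ∪ Y, v ∉ F ∧ v ∉ F' ∧ (∀ x ∈ F, x ∈ φ v) ∧ ∀ x ∈ F', x ∉ φ v ∧ v ∉ φ x) ∧
      (∀ᵐ v ∂(P : Measure V), v ∈ X) ∧ (∀ᵐ v ∂(Q : Measure V), v ∈ Y) ∧
      (∀ d ∈ D, |edgeFreq P d - edgeFreq Q d| < ε) ∧
      1 - (1 / 2) ^ j ≤ edgeFreq P (extensionGraph φ) ∧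
      edgeFreq Q (extensionGraph φ) ≤ (1 / 2) ^ j := by
  -- `F` and `F'` vary so that the second use of the induction hypothesis can take `F ∪ X` and `F' ∪
  -- Y`, which fixes all adjacencies between the two rounds.
  induction j generalizing F F' with
  | zero =>
    obtain ⟨P, Q, X, Y, hX, hY, hXY, hP, hQ, h⟩ :=
      exists_close_disjoint hD hε (infinite_extension φ hF)
    refine ⟨P, Q, X, Y, hXY, fun v hv => ?_, hP, hQ, h, by simpa using edgeFreq_nonneg _ _,
      by simpa using edgeFreq_le_one _ _⟩
    obtain hv | hv := Finset.mem_union.1 hv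
    exacts [hX hv, hY hv]
  | succ j ih =>
    obtain ⟨P, Q, X, Y, hXY, hV, hP, hQ, h, hPj, hQj⟩ := ih hF
    have hdisj : Disjoint (F ∪ X) (F' ∪ Y) := by
      rw [Finset.disjoint_union_left, Finset.disjoint_union_right, Finset.disjoint_union_right]
      exact ⟨⟨hF, Finset.disjoint_right.2 fun v hv => (hV v (by simp [hv])).1⟩,
        Finset.disjoint_left.2 fun v hv => (hV v (by simp [hv])).2.1, hXY⟩
    obtain ⟨P', Q', X', Y', hXY', hV', hP', hQ', h', hPj', hQj'⟩ := ih hdisj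
    refine ⟨mix P P', mix Q Q', X ∪ X', Y ∪ Y', ?_, fun v hv => ?_,
      ae_mix (hP.mono fun v hv => Finset.mem_union_left _ hv)
        (hP'.mono fun v hv => Finset.mem_union_right _ hv),
      ae_mix (hQ.mono fun v hv => Finset.mem_union_left _ hv)
        (hQ'.mono fun v hv => Finset.mem_union_right _ hv), fun d hd => ?_, ?_, ?_⟩
    · rw [Finset.disjoint_union_left, Finset.disjoint_union_right, Finset.disjoint_union_right]
      refine ⟨⟨hXY, Finset.disjoint_right.2 fun v hv hv' => ?_⟩,
        Finset.disjoint_left.2 fun v hv hv' => ?_, hXY'⟩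
      · exact (hV' v (by simp [hv])).1 (by simp [hv'])
      · exact (hV' v (by simp [hv])).2.1 (by simp [hv'])
    · have hv' : v ∈ X ∪ Y ∨ v ∈ X' ∪ Y' := by
        simp only [Finset.mem_union] at hv ⊢; tauto
      obtain hv | hv := hv'
      · exact hV v hv
      · obtain ⟨h1, h2, h3, h4⟩ := hV' v hv
        exact ⟨fun h => h1 (by simp [h]), fun h => h2 (by simp [h]),
          fun x hx => h3 x (by simp [hx]), fun x hx => h4 x (by simp [hx])⟩
    · have h1 := abs_lt.1 (h d hd)
      have h2 := abs_lt.1 (h' d hd)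
      rw [edgeFreq_mix_one, edgeFreq_mix_one, abs_lt]
      constructor <;> linarith [h1.1, h1.2, h2.1, h2.2]
    · have hXX : ∀ x y, x ∈ X → y ∈ X' → x ∈ φ y := fun x y hx hy =>
        (hV' y (by simp [hy])).2.2.1 x (by simp [hx])
      rw [edgeFreq_mix_two,
        jointFreq_eq_one hP hP' fun x y hx hy => (mem_extensionGraph φ x y).2 (.inl (hXX x y hx hy)),
        jointFreq_eq_one hP' hP fun x y hx hy => (mem_extensionGraph φ x y).2 (.inr (hXX y x hy hx)),
        pow_succ]
      linarith
    · have hYY : ∀ x y, x ∈ Y → y ∈ Y' → x ∉ φ y ∧ y ∉ φ x := fun x y hx hy =>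
        (hV' y (by simp [hy])).2.2.2 x (by simp [hx])
      rw [edgeFreq_mix_two,
        jointFreq_eq_zero hQ hQ' fun x y hx hy => by
          rw [mem_extensionGraph]; have := hYY x y hx hy; tauto,
        jointFreq_eq_zero hQ' hQ fun x y hx hy => by
          rw [mem_extensionGraph]; have := hYY y x hy hx; tauto,
        pow_succ]
      linarith

/-- Indistinguishable distributions on the membership graph, the first joining its two sides
completely and the second edgeless. -/
lemma exists_close_membershipGraph {V : Type*} [MeasurableSpace V] [DiscreteMeasurableSpace V]
    (e : V ≃ ℕ ⊕ Finset ℕ) {D : Set (Distinguisher V 1)} (hD : vcDim D < ⊤) {ε : ℝ}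
    (hε : 0 < ε) :
    ∃ P Q : ProbabilityMeasure V, (∀ d ∈ D, |edgeFreq P d - edgeFreq Q d| < ε) ∧
      1 / 2 ≤ edgeFreq P (membershipGraph e) ∧ edgeFreq Q (membershipGraph e) = 0 := by
  classical
  obtain ⟨P, Q, X, Y, hX, hY, hXY, hP, hQ, h⟩ := exists_close_disjoint hD hε
    (Set.infinite_range_of_injective (e.symm.injective.comp Sum.inl_injective))
  set a : ℕ → V := fun i => e.symm (.inl i) with ha
  have hinj : a.Injective := e.symm.injective.comp Sum.inl_injective
  -- `A` is the set of indices of `X`; since `Y` is disjoint from `X`, the vertex `w` has no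
  -- neighbour in `Y`.
  set A : Finset ℕ := X.preimage a hinj.injOn with hA
  set w : V := e.symm (.inr A) with hw
  set R : ProbabilityMeasure V := ⟨Measure.dirac w, inferInstance⟩
  have hR : ∀ᵐ v ∂(R : Measure V), v = w := by
    show ∀ᵐ v ∂(Measure.dirac w), v = w
    rw [ae_dirac_iff .of_discrete]
  have hadj : ∀ x ∈ X, ![x, w] ∈ (membershipGraph e).edges ∧
      ![w, x] ∈ (membershipGraph e).edges := fun x hx => by
    obtain ⟨i, rfl⟩ := hX hx
    have hi : i ∈ A := Finset.mem_preimage.2 hx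
    exact ⟨(mem_membershipGraph ..).2 ⟨i, A, hi, .inl ⟨rfl, rfl⟩⟩,
      (mem_membershipGraph ..).2 ⟨i, A, hi, .inr ⟨rfl, rfl⟩⟩⟩
  have hnadj : ∀ x y, x ∈ Y ∨ x = w → y ∈ Y ∨ y = w → ![x, y] ∉ (membershipGraph e).edges := by
    have key : ∀ x y, x ∈ Y ∨ x = w → y ∈ Y ∨ y = w → ∀ (i : ℕ) (B : Finset ℕ), i ∈ B →
        x = e.symm (.inl i) → y ≠ e.symm (.inr B) := by
      rintro x y hx hy i B hi rfl rfl
      have hiY : a i ∈ Y := hx.resolve_right fun h => by simp [hw] at h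
      -- The vertices of `Y` are all of the form `v_i`, so `w` is the only set vertex available.
      have hB : B = A := by
        obtain hy | hy := hy
        · obtain ⟨k, hk⟩ := hY hy
          simp at hk
        · simpa [hw] using hy
      exact Finset.disjoint_left.1 hXY (Finset.mem_preimage.1 (hB ▸ hi)) hiY
    intro x y hx hy hxy
    obtain ⟨i, B, hi, ⟨h1, h2⟩ | ⟨h1, h2⟩⟩ := (mem_membershipGraph ..).1 hxy
    exacts [key x y hx hy i B hi h1 h2, key y x hy hx i B hi h1 h2]
  refine ⟨mix P R, mix Q R, fun d hd => ?_, ?_, ?_⟩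
  · have h1 := abs_lt.1 (h d hd)
    rw [edgeFreq_mix_one, edgeFreq_mix_one, abs_lt]
    constructor <;> linarith [h1.1, h1.2]
  · rw [edgeFreq_mix_two, jointFreq_eq_one hP hR fun x y hx hy => hy ▸ (hadj x hx).1,
      jointFreq_eq_one hR hP fun x y hx hy => hx ▸ (hadj y hy).2]
    linarith [edgeFreq_nonneg P (membershipGraph e), edgeFreq_nonneg R (membershipGraph e)]
  · have hmix : ∀ᵐ v ∂(mix Q R : Measure V), v ∈ Y ∨ v = w :=
      ae_mix (hQ.mono fun _ => .inl) (hR.mono fun _ => .inr)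
    rw [edgeFreq_two, jointFreq_eq_zero hmix hmix hnadj]

end GraphDiscriminator

theorem mainTheorem3 :
    ∃ C : ℝ, 0 < C ∧
      (∃ g : Distinguisher ℕ 2,
        HasSampleComplexity {g} (fun ε δ => C * (Real.log (1 / δ) / ε ^ 2)) ∧
        ∀ D : Set (Distinguisher ℕ 1), vcDim D < ⊤ → ∀ ε : ℝ, 0 < ε →
          ∃ p₁ p₂ : MeasureTheory.ProbabilityMeasure ℕ,
            IPM D p₁ p₂ < ε ∧ 1 / 2 < IPM {g} p₁ p₂) ∧
      (∀ e : ℕ ≃ ℕ ⊕ Finset ℕ,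
        HasSampleComplexity {membershipGraph e}
          (fun ε δ => C * (Real.log (1 / δ) / ε ^ 2)) ∧
        ∀ D : Set (Distinguisher ℕ 1), vcDim D < ⊤ → ∀ ε : ℝ, 0 < ε →
          ∃ p₁ p₂ : MeasureTheory.ProbabilityMeasure ℕ,
            IPM D p₁ p₂ < ε ∧ 1 / 2 ≤ IPM {membershipGraph e} p₁ p₂) := by
  let φ : ℕ ≃ Finset ℕ := (Denumerable.eqv (Finset ℕ)).symm
  -- Any positive constant would do, as the algorithm ignores its samples.
  refine ⟨1, one_pos, ⟨extensionGraph φ, hasSampleComplexity_singleton _ _, fun D hD ε hε => ?_⟩,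
    fun e => ⟨hasSampleComplexity_singleton _ _, fun D hD ε hε => ?_⟩⟩
  · obtain ⟨P, Q, -, -, -, -, -, -, h, hP, hQ⟩ :=
      -- Three rounds give at least `7/8 - 1/8 = 3/4`; the bounds after two give only `1/2`, which
      -- is not strict.
      exists_close_extensionGraph φ hD (half_pos hε) 3 (Finset.disjoint_empty_left ∅)
    refine ⟨P, Q, IPM_lt hε h, ?_⟩
    rw [IPM_singleton]
    norm_num at hP hQ
    exact lt_of_lt_of_le (by linarith) (le_abs_self _)
  · obtain ⟨P, Q, h, hP, hQ⟩ := exists_close_membershipGraph e hD (half_pos hε)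
    refine ⟨P, Q, IPM_lt hε h, ?_⟩
    rw [IPM_singleton, hQ, sub_zero]
    exact hP.trans (le_abs_self _)
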